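/- Let $k$ be a perfect field of characteristic $p>0$, and let $R=\bigoplus_{n\ge 0}R_n$ be a commutative $\mathbb N$-graded $k$-algebra of finite type with $R_0=k$ and $R\neq R_0$. Let $D_R=D_{R/k}=\bigcup_m D^m_{R/k}\subseteq \operatorname{End}_k(R)$ be the ring of $k$-linear differential operators on $R$, where $D^0_{R/k}$ consists of the multiplications by elements of $R$, and $\delta\in D^m_{R/k}$ for $m\ge 1$ if $[\delta,r]\in D^{m-1}_{R/k}$ for all $r\in R$. An operator $\delta\in D_R$ has degree $d\in\mathbb Z$ if $\delta(R_m)\subseteq R_{m+d}$ for all $m$, where $R_j=0$ for $j<0$. If $D_R$ has no nonzero elements of negative degree, then $R$ does not have finite $F$-representation type (FFRT). Here $R$ is said to have FFRT if its Frobenius endomorphism $F$ is finite and there are finitely many finitely generated $R$-modules $M_1,\dots,M_N$ such that for every $e>0$ there are integers $a_{e,1},\dots,a_{e,N}\ge 0$ with $F^e_*R\cong M_1^{\oplus a_{e,1}}\oplus\dots\oplus M_N^{\oplus a_{e,N}}$ as $R$-modules, where $F^e_*R$ is the $R$-module obtained from $R$ by restriction of scalars along $F^e$. -/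

import Mathlib

universe u v

/-- The `R`-module `F^e_* R`: the additive group of `R`, on which `r` acts as multiplication
by `r ^ (p ^ e)`. -/
def FrobeniusPushforward (R : Type v) (_p _e : ℕ) : Type v := R

instance FrobeniusPushforward.instAddCommGroup (R : Type v) [CommRing R] (p e : ℕ) :
    AddCommGroup (FrobeniusPushforward R p e) :=
  inferInstanceAs (AddCommGroup R)

/-- Restriction of scalars of `R` along the `e`-th iterate of the Frobenius `R → R`. -/
noncomputable instance FrobeniusPushforward.instModule (R : Type v) [CommRing R] (p e : ℕ)
    [ExpChar R p] : Module R (FrobeniusPushforward R p e) :=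
  Module.compHom R (iterateFrobenius R p e)

/-- The scalar action on `F^e_* R` is `r • x = r ^ (p ^ e) * x`. -/
theorem FrobeniusPushforward.smul_def (R : Type v) [CommRing R] (p e : ℕ) [ExpChar R p]
    (r : R) (x : FrobeniusPushforward R p e) :
    r • x = (show FrobeniusPushforward R p e from r ^ p ^ e * (show R from x)) := rfl

/-- Finite `F`-representation type: `R` is `F`-finite, and there are finitely many finitely
generated `R`-modules `M₁, …, M_N` such that every `F^e_* R`, `e > 0`, is isomorphic to a direct
sum `M₁^{a₁} ⊕ ⋯ ⊕ M_N^{a_N}`. -/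
def HasFFRT (R : Type v) [CommRing R] (p : ℕ) [ExpChar R p] : Prop :=
  (frobenius R p).Finite ∧
  ∃ (N : ℕ) (M : Fin N → Type v) (_ : ∀ i, AddCommGroup (M i)) (_ : ∀ i, Module R (M i)),
    (∀ i, Module.Finite R (M i)) ∧
    ∀ e : ℕ, 0 < e → ∃ a : Fin N → ℕ,
      Nonempty (FrobeniusPushforward R p e ≃ₗ[R] ((i : Fin N) → Fin (a i) → M i))

/-- `k`-linear differential operators on `R` of order at most `m`: those of order `0` are the
multiplications by elements of `R`, and `δ` has order at most `m + 1` if every commutator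
`[δ, r]`, `r ∈ R`, has order at most `m`. -/
def IsDiffOpOfOrder (k : Type u) (R : Type v) [Field k] [CommRing R] [Algebra k R] :
    ℕ → Module.End k R → Prop
  | 0, δ => ∃ a : R, δ = LinearMap.mulLeft k a
  | m + 1, δ => ∀ r : R,
      IsDiffOpOfOrder k R m (δ * LinearMap.mulLeft k r - LinearMap.mulLeft k r * δ)

/-- The differential operators `D_{R/k}`, the union over `m` of those of order at most `m`. -/
def diffOps (k : Type u) (R : Type v) [Field k] [CommRing R] [Algebra k R] :
    Set (Module.End k R) :=
  {δ | ∃ m : ℕ, IsDiffOpOfOrder k R m δ}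

/-- The pieces of an `ℕ`-grading, indexed by `ℤ`, with zero in negative degrees. -/
def intPiece {k : Type u} {R : Type v} [Field k] [CommRing R] [Algebra k R]
    (𝒜 : ℕ → Submodule k R) : ℤ → Submodule k R
  | Int.ofNat n => 𝒜 n
  | Int.negSucc _ => ⊥

/-- `δ` is homogeneous of degree `d`: `δ(R_m) ⊆ R_{m+d}` for all `m`. -/
def IsHomogeneousOfDegree {k : Type u} {R : Type v} [Field k] [CommRing R] [Algebra k R]
    (𝒜 : ℕ → Submodule k R) (δ : Module.End k R) (d : ℤ) : Prop :=
  ∀ m : ℕ, ∀ x ∈ 𝒜 m, δ x ∈ intPiece 𝒜 ((m : ℤ) + d)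

/-!
The proof compares two estimates for chains of submodules of `F^e_* R`, with `q = p ^ e`.

Since `k` is perfect, the `R`-linear endomorphisms of `F^e_* R` are the `k`-linear operators on `R`
that are linear over the `q`-th powers, and these are differential operators
(`mem_diffOps_of_pow_linear`). The homogeneous components of such an operator are again of this
kind (`lowerComponent_pow_linear`), so if there are no operators of negative degree, then every
endomorphism of `F^e_* R` preserves the filtration of `R` by the ideals
`gradedTail 𝒜 n = ⨁_{j ≥ n} R_j` (`map_mem_gradedTail`). For `n ≤ q` these ideals contain
`𝔪 • F^e_* R`, where `𝔪 = gradedTail 𝒜 1`, and the step from `n` to `n + 1` is strict whenever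
`R_n ≠ 0`.

On the other hand, if `F^e_* R ≅ ⨁ i, M i ^ a i`, then a fully invariant submodule `W` of `F^e_* R`
is determined by the submodules `summandTrace φ W i` of the `M i` (`le_of_summandTrace_le`), because
the endomorphisms include all the maps moving one copy of `M i` to another. A descending chain of
fully invariant submodules containing `𝔪 • F^e_* R` thus has at most `∑ i, length (M i ⧸ 𝔪 • M i)`
strict steps (`card_strict_steps_le`), a bound that does not depend on the multiplicities `a i`
and hence not on `e`. No Krull-Schmidt theorem is needed. Under FFRT, it follows that only finitely
many `R_n` are nonzero.

But then `R` is a finite-dimensional local algebra different from `k`, the `q`-th powers lie in `k`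
for large `q`, and a nonzero linear functional on some `R_d`, `d > 0`, is an operator of negative
degree (`infinite_setOf_piece_ne_bot`).
-/

open TensorProduct DirectSum

/-! ### Operators linear over the `q`-th powers are differential operators -/

section DiffOps

variable {k : Type u} {R : Type v} [Field k] [CommRing R] [Algebra k R]

/-- The action of `R ⊗[k] R` on `End_k R` in which `a ⊗ b` sends `δ` to `x ↦ a * δ (b * x)`. -/
noncomputable def bimoduleAction (k : Type u) (R : Type v) [Field k] [CommRing R] [Algebra k R] :
    R ⊗[k] R →ₐ[k] Module.End k (Module.End k R) :=
  Algebra.TensorProduct.lift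
    ((Algebra.lmul k (Module.End k R)).comp (Algebra.lmul k R))
    (AlgHom.ofLinearMap
      (((LinearMap.mul k (Module.End k R)).flip).comp (Algebra.lmul k R).toLinearMap)
      (by ext; simp)
      (fun a b => by ext δ x; simp [mul_left_comm, mul_assoc]))
    (fun a b => (commute_iff_eq _ _).2 (by ext δ x; simp))

@[simp]
theorem bimoduleAction_tmul_apply (a b x : R) (δ : Module.End k R) :
    bimoduleAction k R (a ⊗ₜ b) δ x = a * δ (b * x) := by
  rw [bimoduleAction, Algebra.TensorProduct.lift_tmul]
  simp

/-- The ideal of elements of `R ⊗[k] R` killing the operator `δ`. -/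
noncomputable def bimoduleAnnihilator (δ : Module.End k R) : Ideal (R ⊗[k] R) where
  carrier := {t | bimoduleAction k R t δ = 0}
  add_mem' {s t} hs ht := by simp_all
  zero_mem' := by simp
  smul_mem' s t ht := by simp_all

theorem mem_bimoduleAnnihilator {δ : Module.End k R} {t : R ⊗[k] R} :
    t ∈ bimoduleAnnihilator δ ↔ bimoduleAction k R t δ = 0 := Iff.rfl

/-- Grothendieck's description of the order of a differential operator, in terms of the powers
of the kernel of `R ⊗[k] R → R`. -/
theorem isDiffOpOfOrder_of_pow_le_bimoduleAnnihilator (m : ℕ) (δ : Module.End k R)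
    (h : KaehlerDifferential.ideal k R ^ (m + 1) ≤ bimoduleAnnihilator δ) :
    IsDiffOpOfOrder k R m δ := by
  induction m generalizing δ with
  | zero =>
    refine ⟨δ 1, LinearMap.ext fun x => ?_⟩
    have hx := h ((pow_one (KaehlerDifferential.ideal k R)).symm ▸
      KaehlerDifferential.one_smul_sub_smul_one_mem_ideal k x)
    have := LinearMap.congr_fun (mem_bimoduleAnnihilator.1 hx) 1
    simpa [sub_eq_zero, mul_comm] using this
  | succ m ih =>
    intro r
    refine ih _ fun t ht => ?_
    have hr := h (by
      rw [pow_succ]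
      exact Ideal.mul_mem_mul ht (KaehlerDifferential.one_smul_sub_smul_one_mem_ideal k r))
    rw [mem_bimoduleAnnihilator, map_mul, Module.End.mul_apply] at hr
    rw [mem_bimoduleAnnihilator, ← hr]
    congr 1
    ext x
    simp

/-- Since `(1 ⊗ s - s ⊗ 1) ^ q = 1 ⊗ s ^ q - s ^ q ⊗ 1`, the kernel of `R ⊗[k] R → R` lies in the
radical of the annihilator of an operator linear over the `q`-th powers, and it is finitely
generated. -/
theorem mem_diffOps_of_pow_linear (p : ℕ) [Fact p.Prime] [CharP k p]
    [Algebra.FiniteType k R] (e : ℕ) (δ : Module.End k R)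
    (hδ : ∀ s x : R, δ (s ^ p ^ e * x) = s ^ p ^ e * δ x) : δ ∈ diffOps k R := by
  have : Algebra.FiniteType k (R ⊗[k] R) := .trans ‹Algebra.FiniteType k R› inferInstance
  have : IsNoetherianRing (R ⊗[k] R) := Algebra.FiniteType.isNoetherianRing k _
  have hrad : KaehlerDifferential.ideal k R ≤ (bimoduleAnnihilator δ).radical := by
    rw [← KaehlerDifferential.span_range_eq_ideal, Ideal.span_le]
    rintro _ ⟨s, rfl⟩
    refine ⟨p ^ e, ?_⟩
    rcases subsingleton_or_nontrivial (R ⊗[k] R) with h | h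
    · rw [Subsingleton.elim (((1 : R) ⊗ₜ[k] s - s ⊗ₜ[k] (1 : R)) ^ p ^ e) 0]
      exact zero_mem _
    have : CharP (R ⊗[k] R) p := charP_of_injective_algebraMap' k p
    rw [sub_pow_char_pow, Algebra.TensorProduct.tmul_pow, Algebra.TensorProduct.tmul_pow,
      mem_bimoduleAnnihilator]
    ext x
    simp [hδ]
  obtain ⟨n, hn⟩ := Ideal.exists_pow_le_of_le_radical_of_fg hrad
    (Ideal.fg_of_isNoetherianRing _)
  exact ⟨n, isDiffOpOfOrder_of_pow_le_bimoduleAnnihilator n δ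
    ((Ideal.pow_le_pow_right n.le_succ).trans hn)⟩

end DiffOps

/-! ### Homogeneous components of operators -/

section Graded

variable {k : Type u} {R : Type v} [Field k] [CommRing R] [Algebra k R]
  (𝒜 : ℕ → Submodule k R) [GradedAlgebra 𝒜]

/-- The ideal of elements whose homogeneous components of degree less than `n` vanish. -/
def gradedTail (n : ℕ) : Ideal R where
  carrier := {x | ∀ j < n, (decompose 𝒜 x j : R) = 0}
  add_mem' {x y} hx hy j hj := by simp [hx j hj, hy j hj]
  zero_mem' j _ := by simp
  smul_mem' r x hx j hj := by
    induction r using Decomposition.inductionOn 𝒜 with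
    | zero => simp
    | @homogeneous i r =>
      by_cases hij : i ≤ j
      · rw [smul_eq_mul, coe_decompose_mul_of_left_mem_of_le 𝒜 r.2 hij,
          hx _ ((Nat.sub_le j i).trans_lt hj), mul_zero]
      · rw [smul_eq_mul, coe_decompose_mul_of_left_mem_of_not_le 𝒜 r.2 hij]
    | add r s hr hs =>
      rw [add_smul, decompose_add, DirectSum.add_apply, Submodule.coe_add, hr, hs, add_zero]

variable {𝒜}

theorem mem_gradedTail {n : ℕ} {x : R} :
    x ∈ gradedTail 𝒜 n ↔ ∀ j < n, (decompose 𝒜 x j : R) = 0 := Iff.rfl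

theorem gradedTail_antitone : Antitone (gradedTail 𝒜) :=
  fun _ _ h _ hx j hj => hx j (hj.trans_le h)

theorem mem_gradedTail_of_mem {n i : ℕ} (h : n ≤ i) {x : R} (hx : x ∈ 𝒜 i) :
    x ∈ gradedTail 𝒜 n := fun j hj => decompose_of_mem_ne 𝒜 hx (by omega)

theorem gradedTail_mul_mem {m n : ℕ} {x y : R} (hx : x ∈ gradedTail 𝒜 m)
    (hy : y ∈ gradedTail 𝒜 n) : x * y ∈ gradedTail 𝒜 (m + n) := by
  classical
  rw [← sum_support_decompose 𝒜 x, Finset.sum_mul]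
  refine Ideal.sum_mem _ fun i hi j hj => ?_
  have hmi : m ≤ i := by
    by_contra hlt
    exact (DFinsupp.mem_support_iff.1 hi) (Subtype.ext (hx i (not_le.1 hlt)))
  by_cases hij : i ≤ j
  · rw [coe_decompose_mul_of_left_mem_of_le 𝒜 (decompose 𝒜 x i).2 hij, hy _ (by omega), mul_zero]
  · rw [coe_decompose_mul_of_left_mem_of_not_le 𝒜 (decompose 𝒜 x i).2 hij]

theorem gradedTail_pow_mem {n : ℕ} {x : R} (hx : x ∈ gradedTail 𝒜 n) (q : ℕ) :
    x ^ q ∈ gradedTail 𝒜 (q * n) := by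
  induction q with
  | zero => exact fun j hj => by omega
  | succ q ih => simpa [pow_succ, Nat.succ_mul] using gradedTail_mul_mem ih hx

theorem gradedTail_succ_lt {n : ℕ} (h : 𝒜 n ≠ ⊥) : gradedTail 𝒜 (n + 1) < gradedTail 𝒜 n := by
  refine lt_of_le_of_ne (gradedTail_antitone n.le_succ) fun heq => h ?_
  refine (Submodule.eq_bot_iff _).2 fun x hx => ?_
  have : x ∈ gradedTail 𝒜 (n + 1) := heq ▸ mem_gradedTail_of_mem le_rfl hx
  simpa [decompose_of_mem_same 𝒜 hx] using this n n.lt_succ_self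

variable (𝒜)

/-- The homogeneous component of degree `-c` of a `k`-linear operator: it maps `x` of degree `i` to
the component of `δ x` of degree `i - c`, and to `0` if `i < c`. -/
noncomputable def lowerComponent (c : ℕ) (δ : Module.End k R) : Module.End k R :=
  (DirectSum.toModule k ℕ R fun i =>
    if c ≤ i then
      (𝒜 (i - c)).subtype ∘ₗ DirectSum.component k ℕ (fun n => 𝒜 n) (i - c) ∘ₗ
        (decomposeLinearEquiv 𝒜).toLinearMap ∘ₗ δ ∘ₗ (𝒜 i).subtype
    else 0) ∘ₗ (decomposeLinearEquiv 𝒜).toLinearMap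

theorem lowerComponent_apply_of_mem {c i : ℕ} (δ : Module.End k R) {x : R} (hx : x ∈ 𝒜 i) :
    lowerComponent 𝒜 c δ x = if c ≤ i then (decompose 𝒜 (δ x) (i - c) : R) else 0 := by
  lift x to 𝒜 i using hx
  rw [lowerComponent, LinearMap.comp_apply, LinearEquiv.coe_coe, decomposeLinearEquiv_apply,
    decompose_coe, ← DirectSum.lof_eq_of k, DirectSum.toModule_lof]
  split_ifs <;> rfl

theorem lowerComponent_isHomogeneous (c : ℕ) (δ : Module.End k R) :
    IsHomogeneousOfDegree 𝒜 (lowerComponent 𝒜 c δ) (-c) := by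
  intro m x hx
  rw [lowerComponent_apply_of_mem 𝒜 δ hx]
  split_ifs with h
  · rw [show (m : ℤ) + -c = Int.ofNat (m - c) by rw [Int.ofNat_eq_natCast]; omega]
    exact (decompose 𝒜 (δ x) (m - c)).2
  · exact zero_mem _

theorem lowerComponent_pow_linear (p : ℕ) [Fact p.Prime] [CharP R p] (e c : ℕ)
    (δ : Module.End k R) (hδ : ∀ s x : R, δ (s ^ p ^ e * x) = s ^ p ^ e * δ x) (s x : R) :
    lowerComponent 𝒜 c δ (s ^ p ^ e * x) = s ^ p ^ e * lowerComponent 𝒜 c δ x := by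
  induction s using Decomposition.inductionOn 𝒜 with
  | zero => simp [(Fact.out : p.Prime).ne_zero]
  | add s t hs ht => rw [add_pow_char_pow, add_mul, map_add, hs, ht, add_mul]
  | @homogeneous a s =>
    induction x using Decomposition.inductionOn 𝒜 with
    | zero => simp
    | add x y hx hy => rw [mul_add, map_add, hx, hy, map_add, mul_add]
    | @homogeneous i x =>
      obtain ⟨b, hs⟩ : ∃ b, (s : R) ^ p ^ e ∈ 𝒜 b := ⟨_, SetLike.pow_mem_graded _ s.2⟩
      rw [lowerComponent_apply_of_mem 𝒜 δ x.2,
        lowerComponent_apply_of_mem 𝒜 δ (SetLike.mul_mem_graded hs x.2), hδ]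
      by_cases hci : c ≤ i
      · rw [if_pos hci, if_pos (by omega),
          coe_decompose_mul_of_left_mem_of_le 𝒜 hs (by omega),
          show b + i - c - b = i - c by omega]
      · rw [if_neg hci, mul_zero]
        -- `x` has degree `i < c`, but `s ^ q * x` may have degree at least `c`: then the relevant
        -- component of `s ^ q * δ x` lies in degree less than that of `s ^ q`.
        split_ifs with h
        · exact coe_decompose_mul_of_left_mem_of_not_le 𝒜 hs (by omega)
        · rfl

/-- Without operators of negative degree, no operator linear over the `q`-th powers lowers the
least degree occurring in an element. -/
theorem map_mem_gradedTail (p : ℕ) [Fact p.Prime] [CharP k p] [CharP R p]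
    [Algebra.FiniteType k R]
    (hneg : ∀ δ ∈ diffOps k R, ∀ d : ℤ, d < 0 → IsHomogeneousOfDegree 𝒜 δ d → δ = 0)
    (e : ℕ) (δ : Module.End k R) (hδ : ∀ s x : R, δ (s ^ p ^ e * x) = s ^ p ^ e * δ x)
    {n : ℕ} {x : R} (hx : x ∈ gradedTail 𝒜 n) : δ x ∈ gradedTail 𝒜 n := by
  classical
  rw [← sum_support_decompose 𝒜 x, map_sum]
  refine Ideal.sum_mem _ fun i hi j hj => ?_
  have hni : n ≤ i := by
    by_contra hlt
    exact (DFinsupp.mem_support_iff.1 hi) (Subtype.ext (hx i (not_le.1 hlt)))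
  -- The component of degree `j < i` of `δ x_i` is the value at `x_i` of an operator of
  -- degree `j - i`.
  have h0 : lowerComponent 𝒜 (i - j) δ = 0 :=
    hneg _ (mem_diffOps_of_pow_linear p e _ (lowerComponent_pow_linear 𝒜 p e _ δ hδ)) _
      (by omega) (lowerComponent_isHomogeneous 𝒜 _ δ)
  have h1 := lowerComponent_apply_of_mem 𝒜 (c := i - j) δ (decompose 𝒜 x i).2
  rw [h0, if_pos (Nat.sub_le i j), Nat.sub_sub_self (by omega)] at h1
  simpa using h1.symm

theorem exists_sub_algebraMap_mem_gradedTail_one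
    (hk : Function.Bijective (algebraMap k (𝒜 0))) (x : R) :
    ∃ c : k, x - algebraMap k R c ∈ gradedTail 𝒜 1 := by
  obtain ⟨c, hc⟩ := hk.2 (decompose 𝒜 x 0)
  refine ⟨c, fun j hj => ?_⟩
  obtain rfl : j = 0 := by omega
  have hc' : algebraMap k R c = decompose 𝒜 x 0 := congrArg Subtype.val hc
  rw [hc', decompose_sub, decompose_coe, DirectSum.sub_apply, DirectSum.of_eq_same, sub_self]
  rfl

/-- If only finitely many graded pieces are nonzero, a linear functional on a piece of positive
degree is linear over the `q`-th powers for large `q`, and is thus a differential operator. -/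
theorem infinite_setOf_piece_ne_bot (p : ℕ) [Fact p.Prime] [CharP k p] [CharP R p]
    [Algebra.FiniteType k R] (hk : Function.Bijective (algebraMap k (𝒜 0))) (hne : 𝒜 0 ≠ ⊤)
    (hneg : ∀ δ ∈ diffOps k R, ∀ d : ℤ, d < 0 → IsHomogeneousOfDegree 𝒜 δ d → δ = 0) :
    {n | 𝒜 n ≠ ⊥}.Infinite := by
  intro hfin
  obtain ⟨B, hB⟩ := hfin.bddAbove
  have htail : ∀ x ∈ gradedTail 𝒜 (B + 1), x = 0 := by
    classical
    intro x hx
    rw [← sum_support_decompose 𝒜 x]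
    refine Finset.sum_eq_zero fun i _ => ?_
    by_cases hi : i < B + 1
    · exact hx i hi
    · by_contra h
      have := hB (show 𝒜 i ≠ ⊥ from fun h0 =>
        h ((Submodule.eq_bot_iff _).1 h0 _ (decompose 𝒜 x i).2))
      omega
  obtain ⟨d, hd, hd0⟩ : ∃ d, 0 < d ∧ 𝒜 d ≠ ⊥ := by
    by_contra! h
    refine hne (eq_top_iff.2 fun x _ => ?_)
    classical
    rw [← sum_support_decompose 𝒜 x]
    refine Submodule.sum_mem _ fun i _ => ?_
    rcases Nat.eq_zero_or_pos i with rfl | hi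
    · exact (decompose 𝒜 x 0).2
    · rw [(Submodule.eq_bot_iff _).1 (h i hi) _ (decompose 𝒜 x i).2]
      exact zero_mem _
  obtain ⟨y, hy, hy0⟩ := Submodule.exists_mem_ne_zero_of_ne_bot hd0
  obtain ⟨f, hf⟩ := Module.Projective.exists_dual_ne_zero k
    (show (⟨y, hy⟩ : 𝒜 d) ≠ 0 from fun h => hy0 (congrArg Subtype.val h))
  -- The operator of degree `-d` sending `x` to the scalar `f (x_d)`.
  let δ : Module.End k R := Algebra.linearMap k R ∘ₗ f ∘ₗ
    DirectSum.component k ℕ (fun n => 𝒜 n) d ∘ₗ (decomposeLinearEquiv 𝒜).toLinearMap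
  have hδ : ∀ x, δ x = algebraMap k R (f (decompose 𝒜 x d)) := fun _ => rfl
  have hlin : ∀ s x : R, δ (s ^ p ^ (B + 1) * x) = s ^ p ^ (B + 1) * δ x := by
    intro s x
    obtain ⟨c, hc⟩ := exists_sub_algebraMap_mem_gradedTail_one 𝒜 hk s
    -- `s` is a scalar up to an element `t` of the irrelevant ideal, and `t ^ q = 0` for reasons
    -- of degree, so that `s ^ q` is a scalar.
    have hq : B + 1 ≤ p ^ (B + 1) := (Nat.lt_pow_self (Fact.out : p.Prime).one_lt).le
    have h0 := htail _ (gradedTail_antitone (by simpa using hq)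
      (gradedTail_pow_mem hc (p ^ (B + 1))))
    rw [sub_pow_char_pow, sub_eq_zero] at h0
    rw [h0, ← map_pow, ← Algebra.smul_def, ← Algebra.smul_def, map_smul]
  have h := hneg δ (mem_diffOps_of_pow_linear p _ δ hlin) (-d) (by omega) fun m x hx => by
    rw [hδ]
    rcases eq_or_ne m d with rfl | hmd
    · rw [add_neg_cancel]
      exact SetLike.algebraMap_mem_graded 𝒜 _
    · rw [show decompose 𝒜 x d = 0 from Subtype.ext (decompose_of_mem_ne 𝒜 hx hmd), map_zero,
        map_zero]
      exact zero_mem _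
  have hR : Nontrivial R := ⟨y, 0, hy0⟩
  have h1 : algebraMap k R (f (decompose 𝒜 y d)) = 0 := by rw [← hδ, h, LinearMap.zero_apply]
  rw [FaithfulSMul.algebraMap_eq_zero_iff] at h1
  exact hf (by rw [← h1]; congr 1; exact Subtype.ext (decompose_of_mem_same 𝒜 hy).symm)

/-- The irrelevant ideal is maximal when the piece of degree `0` is the base field. -/
theorem isMaximal_gradedTail_one [Nontrivial R] (hk : Function.Bijective (algebraMap k (𝒜 0))) :
    (gradedTail 𝒜 1).IsMaximal := by
  refine Ideal.isMaximal_iff.2 ⟨fun h => ?_, fun J x hJ hx hxJ => ?_⟩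
  · have := h 0 one_pos
    rw [decompose_of_mem_same 𝒜 SetLike.GradedOne.one_mem] at this
    exact one_ne_zero this
  · obtain ⟨c, hc⟩ := exists_sub_algebraMap_mem_gradedTail_one 𝒜 hk x
    have hc0 : c ≠ 0 := fun h => hx (by simpa [h] using hc)
    have hcJ : algebraMap k R c ∈ J := by simpa using J.sub_mem hxJ (hJ hc)
    have := J.mul_mem_left (algebraMap k R c⁻¹) hcJ
    rwa [← map_mul, inv_mul_cancel₀ hc0, map_one] at this

end Graded

/-! ### Fully invariant submodules of a direct sum of copies of finitely many modules -/

section FullyInvariant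

variable {R : Type v} [CommRing R]

theorem length_quotient_ne_top_of_smul_top_le {M : Type*} [AddCommGroup M] [Module R M]
    [Module.Finite R M] (I : Ideal R) [I.IsMaximal] {N : Submodule R M} (h : I • ⊤ ≤ N) :
    Module.length R (M ⧸ N) ≠ ⊤ := by
  let _ : Field (R ⧸ I) := Ideal.Quotient.field I
  have hI : Module.length R (M ⧸ (I • ⊤ : Submodule R M)) ≠ ⊤ := by
    rw [Module.length_eq_of_surjective (R := R ⧸ I) Ideal.Quotient.mk_surjective]
    have : Module.Finite (R ⧸ I) (M ⧸ (I • ⊤ : Submodule R M)) := .of_restrictScalars_finite R _ _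
    exact Module.length_ne_top
  exact ne_top_of_le_ne_top hI
    (Module.length_le_of_surjective (Submodule.factor h) (Submodule.factor_surjective h))

theorem length_quotient_lt_of_lt {M : Type*} [AddCommGroup M] [Module R M]
    {N N' : Submodule R M} (h : N < N') (hN : Module.length R (M ⧸ N) ≠ ⊤) :
    Module.length R (M ⧸ N') < Module.length R (M ⧸ N) := by
  obtain ⟨_, _⟩ := isFiniteLength_iff_isNoetherian_isArtinian.1 (Module.length_ne_top_iff.1 hN)
  rw [← (Submodule.quotientQuotientEquivQuotient N N' h.le).length_eq]
  refine Submodule.length_quotient_lt _ fun hbot => h.not_ge ?_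
  rwa [← le_bot_iff, Submodule.map_le_iff_le_comap, Submodule.comap_bot,
    Submodule.ker_mkQ] at hbot

variable {ι : Type*} [DecidableEq ι] {M : ι → Type*} [∀ i, AddCommGroup (M i)]
  [∀ i, Module R (M i)] {a : ι → ℕ} {P : Type*} [AddCommGroup P] [Module R P]

/-- The inclusion of the `s`-th copy of `M i` into a module decomposed as `⨁ i, M i ^ a i`. -/
def summandInclusion (φ : P ≃ₗ[R] ((i : ι) → Fin (a i) → M i)) (i : ι) (s : Fin (a i)) :
    M i →ₗ[R] P :=
  φ.symm.toLinearMap ∘ₗ LinearMap.single R (fun i => Fin (a i) → M i) i ∘ₗ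
    LinearMap.single R (fun _ => M i) s

/-- The projection onto the `s`-th copy of `M i` of a module decomposed as `⨁ i, M i ^ a i`. -/
def summandProjection (φ : P ≃ₗ[R] ((i : ι) → Fin (a i) → M i)) (i : ι) (s : Fin (a i)) :
    P →ₗ[R] M i :=
  LinearMap.proj s ∘ₗ LinearMap.proj i ∘ₗ φ.toLinearMap

theorem sum_summandInclusion_summandProjection [Fintype ι]
    (φ : P ≃ₗ[R] ((i : ι) → Fin (a i) → M i))
    (x : P) : ∑ i, ∑ s, summandInclusion φ i s (summandProjection φ i s x) = x := by
  apply φ.injective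
  funext i
  simp only [summandInclusion, summandProjection, map_sum, LinearMap.comp_apply,
    LinearEquiv.coe_coe, LinearEquiv.apply_symm_apply, LinearMap.coe_single,
    LinearMap.proj_apply, Finset.sum_apply]
  rw [Finset.sum_eq_single i (fun j _ hj => Finset.sum_eq_zero fun _ _ =>
    Pi.single_eq_of_ne hj.symm _) (by simp)]
  simp only [Pi.single_eq_same]
  exact Finset.univ_sum_single (φ x i)

/-- The elements of `M i` whose image under every inclusion `M i → ⨁ i, M i ^ a i` lies
in `W`. -/
def summandTrace (φ : P ≃ₗ[R] ((i : ι) → Fin (a i) → M i)) (W : Submodule R P) (i : ι) :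
    Submodule R (M i) :=
  ⨅ s, W.comap (summandInclusion φ i s)

variable (φ : P ≃ₗ[R] ((i : ι) → Fin (a i) → M i))

theorem mem_summandTrace {W : Submodule R P} {i : ι} {y : M i} :
    y ∈ summandTrace φ W i ↔ ∀ s, summandInclusion φ i s y ∈ W := by
  simp [summandTrace]

theorem summandTrace_mono {W W' : Submodule R P} (h : W ≤ W') (i : ι) :
    summandTrace φ W i ≤ summandTrace φ W' i :=
  fun _ hy => (mem_summandTrace φ).2 fun s => h ((mem_summandTrace φ).1 hy s)

/-- A fully invariant submodule is determined by its traces: the endomorphisms moving one copy of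
`M i` to another send `x ∈ W` to the images of its coordinates. -/
theorem le_of_summandTrace_le [Fintype ι] {W W' : Submodule R P}
    (hW : ∀ f : P →ₗ[R] P, ∀ x ∈ W, f x ∈ W)
    (h : ∀ i, summandTrace φ W i ≤ summandTrace φ W' i) : W ≤ W' := by
  intro x hx
  rw [← sum_summandInclusion_summandProjection φ x]
  refine Submodule.sum_mem _ fun i _ => Submodule.sum_mem _ fun s _ => ?_
  refine (mem_summandTrace φ).1 (h i ((mem_summandTrace φ).2 fun t => ?_)) s
  exact hW (summandInclusion φ i t ∘ₗ summandProjection φ i s) x hx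

theorem smul_top_le_summandTrace {I : Ideal R} {W : Submodule R P} (h : I • ⊤ ≤ W) (i : ι) :
    I • ⊤ ≤ summandTrace φ W i := by
  refine Submodule.smul_le.2 fun r hr y _ => (mem_summandTrace φ).2 fun s => ?_
  rw [map_smul]
  exact h (Submodule.smul_mem_smul hr trivial)

/-- The sum over `i` of the lengths of `M i ⧸ summandTrace φ W i`. -/
noncomputable def traceColength [Fintype ι] (W : Submodule R P) : ℕ :=
  ∑ i, (Module.length R (M i ⧸ summandTrace φ W i)).toNat

theorem traceColength_le [Fintype ι] [∀ i, Module.Finite R (M i)] (I : Ideal R) [I.IsMaximal]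
    {W : Submodule R P} (h : I • ⊤ ≤ W) :
    traceColength φ W ≤ ∑ i, (Module.length R (M i ⧸ (I • ⊤ : Submodule R (M i)))).toNat :=
  Finset.sum_le_sum fun i _ => ENat.toNat_le_toNat
    (Module.length_le_of_surjective (Submodule.factor (smul_top_le_summandTrace φ h i))
      (Submodule.factor_surjective _))
    (length_quotient_ne_top_of_smul_top_le I le_rfl)

theorem traceColength_lt_of_lt [Fintype ι] [∀ i, Module.Finite R (M i)] (I : Ideal R)
    [I.IsMaximal]
    {W W' : Submodule R P} (hI : I • ⊤ ≤ W) (hW' : ∀ f : P →ₗ[R] P, ∀ x ∈ W', f x ∈ W')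
    (h : W < W') : traceColength φ W' < traceColength φ W := by
  have hfin : ∀ i, Module.length R (M i ⧸ summandTrace φ W i) ≠ ⊤ := fun i =>
    length_quotient_ne_top_of_smul_top_le I (smul_top_le_summandTrace φ hI i)
  have hle : ∀ i, Module.length R (M i ⧸ summandTrace φ W' i) ≤
      Module.length R (M i ⧸ summandTrace φ W i) := fun i =>
    Module.length_le_of_surjective (Submodule.factor (summandTrace_mono φ h.le i))
      (Submodule.factor_surjective _)
  obtain ⟨i, hi⟩ : ∃ i, ¬ summandTrace φ W' i ≤ summandTrace φ W i := by
    by_contra! hall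
    exact h.not_ge (le_of_summandTrace_le φ hW' hall)
  refine Finset.sum_lt_sum (fun i _ => ENat.toNat_le_toNat (hle i) (hfin i))
    ⟨i, Finset.mem_univ i, ?_⟩
  have hlt := length_quotient_lt_of_lt
    (lt_of_le_not_ge (summandTrace_mono φ h.le i) hi) (hfin i)
  rwa [← ENat.natCast_lt_natCast, ENat.natCast_toNat hlt.ne_top, ENat.natCast_toNat (hfin i)]

/-- The number of strict steps in a descending chain of fully invariant submodules containing
`I • P` is bounded by the lengths of the `M i ⧸ I • M i`, whatever the multiplicities `a i`. -/
theorem card_strict_steps_le [Fintype ι] [∀ i, Module.Finite R (M i)]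
    (φ : P ≃ₗ[R] ((i : ι) → Fin (a i) → M i)) (I : Ideal R) [I.IsMaximal] (q : ℕ)
    (W : ℕ → Submodule R P) (hanti : Antitone W) (hI : ∀ n ≤ q, I • ⊤ ≤ W n)
    (hW : ∀ n, ∀ f : P →ₗ[R] P, ∀ x ∈ W n, f x ∈ W n)
    (S : Set ℕ) [DecidablePred (· ∈ S)] (hS : ∀ n ∈ S, W (n + 1) < W n) :
    ((Finset.range q).filter (· ∈ S)).card ≤
      ∑ i, (Module.length R (M i ⧸ (I • ⊤ : Submodule R (M i)))).toNat := by
  have key : ∀ n ≤ q, ((Finset.range n).filter (· ∈ S)).card ≤ traceColength φ (W n) := by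
    intro n
    induction n with
    | zero => simp
    | succ n ih =>
      intro hn
      specialize ih (by omega)
      rw [Finset.range_add_one, Finset.filter_insert]
      split_ifs with hnS
      · rw [Finset.card_insert_of_notMem (by simp)]
        have := traceColength_lt_of_lt φ I (hI _ hn) (hW n) (hS n hnS)
        omega
      · refine ih.trans (Finset.sum_le_sum fun i _ => ENat.toNat_le_toNat ?_
          (length_quotient_ne_top_of_smul_top_le I
            (smul_top_le_summandTrace φ (hI _ hn) i)))
        exact Module.length_le_of_surjective
          (Submodule.factor (summandTrace_mono φ (hanti n.le_succ) i))
          (Submodule.factor_surjective _)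
  exact (key q le_rfl).trans (traceColength_le φ I (hI q le_rfl))

end FullyInvariant

/-! ### The filtration of `F^e_* R` by degree -/

section Pushforward

variable {k : Type u} {R : Type v} [Field k] [CommRing R] [Algebra k R]
  (𝒜 : ℕ → Submodule k R) [GradedAlgebra 𝒜] (p : ℕ) [Fact p.Prime] [CharP R p]

/-- The ideal `gradedTail 𝒜 n` of `R`, as an `R`-submodule of `F^e_* R`. -/
def pushforwardTail (e n : ℕ) : Submodule R (FrobeniusPushforward R p e) where
  carrier := {x | (show R from x) ∈ gradedTail 𝒜 n}
  add_mem' hx hy := (gradedTail 𝒜 n).add_mem hx hy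
  zero_mem' := (gradedTail 𝒜 n).zero_mem
  smul_mem' r _ hx := (gradedTail 𝒜 n).mul_mem_left (r ^ p ^ e) hx

theorem pushforwardTail_antitone (e : ℕ) : Antitone (pushforwardTail 𝒜 p e) := by
  intro m n h x hx
  have hle : gradedTail 𝒜 n ≤ gradedTail 𝒜 m := gradedTail_antitone h
  exact hle hx

theorem pushforwardTail_succ_lt {e n : ℕ} (h : 𝒜 n ≠ ⊥) :
    pushforwardTail 𝒜 p e (n + 1) < pushforwardTail 𝒜 p e n := by
  obtain ⟨x, hx, hx'⟩ := SetLike.exists_of_lt (gradedTail_succ_lt h)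
  exact lt_of_le_not_ge (pushforwardTail_antitone 𝒜 p e n.le_succ) fun hle => hx' (hle hx)

theorem smul_top_le_pushforwardTail {e n : ℕ} (h : n ≤ p ^ e) :
    gradedTail 𝒜 1 • ⊤ ≤ pushforwardTail 𝒜 p e n := by
  refine Submodule.smul_le.2 fun r hr x _ => ?_
  have hmem := gradedTail_antitone h
    (show r ^ p ^ e ∈ gradedTail 𝒜 (p ^ e) by simpa using gradedTail_pow_mem hr (p ^ e))
  exact (gradedTail 𝒜 n).mul_mem_right (show R from x) hmem

/-- Since `k` is perfect, it consists of `p ^ e`-th powers, so that an `R`-linear endomorphism of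
`F^e_* R` is `k`-linear for the original action of `k` on `R`. -/
theorem pushforwardTail_fullyInvariant [CharP k p] [PerfectField k] [Algebra.FiniteType k R]
    (hneg : ∀ δ ∈ diffOps k R, ∀ d : ℤ, d < 0 → IsHomogeneousOfDegree 𝒜 δ d → δ = 0)
    (e n : ℕ) (f : FrobeniusPushforward R p e →ₗ[R] FrobeniusPushforward R p e)
    (x : FrobeniusPushforward R p e) (hx : x ∈ pushforwardTail 𝒜 p e n) :
    f x ∈ pushforwardTail 𝒜 p e n := by
  let g : R → R := f
  have hg : ∀ s x : R, g (s ^ p ^ e * x) = s ^ p ^ e * g x := fun s x => f.map_smul s x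
  let δ : Module.End k R :=
    { toFun := g
      map_add' := fun x y => f.map_add x y
      map_smul' := fun c x => by
        have : PerfectRing k p := PerfectField.toPerfectRing p
        obtain ⟨b, rfl⟩ := (iterateFrobeniusEquiv k p e).surjective c
        rw [RingHom.id_apply, Algebra.smul_def, Algebra.smul_def, iterateFrobeniusEquiv_def,
          map_pow, hg] }
  exact map_mem_gradedTail 𝒜 p hneg e δ hg hx

end Pushforward

theorem mainTheorem7 (p : ℕ) [Fact p.Prime]
    (k : Type u) [Field k] [CharP k p] [PerfectField k]
    (R : Type v) [CommRing R] [CharP R p] [Algebra k R] [Algebra.FiniteType k R]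
    (𝒜 : ℕ → Submodule k R) [GradedAlgebra 𝒜]
    (hk : Function.Bijective (algebraMap k (𝒜 0)))
    (hne : 𝒜 0 ≠ ⊤)
    (hneg : ∀ δ ∈ diffOps k R, ∀ d : ℤ, d < 0 → IsHomogeneousOfDegree 𝒜 δ d → δ = 0) :
    ¬ HasFFRT R p := by
  classical
  rintro ⟨-, N, M, _, _, hM, hdec⟩
  have : Nontrivial R := CharP.nontrivial_of_char_ne_one (Fact.out : p.Prime).ne_one
  have := isMaximal_gradedTail_one 𝒜 hk
  set B := ∑ i, (Module.length R (M i ⧸ (gradedTail 𝒜 1 • ⊤ : Submodule R (M i)))).toNat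
  have hbound : ∀ e, 0 < e → ((Finset.range (p ^ e)).filter (· ∈ {n | 𝒜 n ≠ ⊥})).card ≤ B := by
    intro e he
    obtain ⟨a, ⟨φ⟩⟩ := hdec e he
    exact card_strict_steps_le φ (gradedTail 𝒜 1) (p ^ e) (pushforwardTail 𝒜 p e)
      (pushforwardTail_antitone 𝒜 p e)
      (fun n hn => smul_top_le_pushforwardTail 𝒜 p hn)
      (fun n => pushforwardTail_fullyInvariant 𝒜 p hneg e n) _
      (fun n hn => pushforwardTail_succ_lt 𝒜 p hn)
  obtain ⟨T, hT, hcard⟩ :=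
    (infinite_setOf_piece_ne_bot 𝒜 p hk hne hneg).exists_subset_card_eq (B + 1)
  obtain ⟨b, hb⟩ := T.bddAbove
  have hsub : T ⊆ (Finset.range (p ^ (b + 1))).filter (· ∈ {n | 𝒜 n ≠ ⊥}) := fun n hn =>
    Finset.mem_filter.2 ⟨Finset.mem_range.2
      ((Nat.lt_succ_of_le (hb hn)).trans (Nat.lt_pow_self (Fact.out : p.Prime).one_lt)), hT hn⟩
  have := (Finset.card_le_card hsub).trans (hbound _ b.succ_pos)
  omega
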